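/- Let $N\ge 1$ and let $\epsilon=(\epsilon_1,\dots,\epsilon_N)$ be a random vector on a probability space such that every $\epsilon_i$ has a finite mean and the joint law of $\epsilon$ (which does not depend on the utilities $v$) is absolutely continuous with respect to Lebesgue measure and has full support $\mathbb{R}^N$. For $v\in\mathbb{R}^N$ let $$W(v)=\mathbb{E}\max_{1\le i\le N}(v_i+\epsilon_i),\qquad q_i(v)=\mathbb{P}\bigl(v_i+\epsilon_i\ge v_j+\epsilon_j\ \text{for all } j\ne i\bigr)$$ be the surplus function and the choice probabilities. Let $H:\mathbb{R}_+^N\to\mathbb{R}_+^N$ be given by $H(e^{v})=\nabla_v\bigl(e^{W(v)}\bigr)$, where $e^v$ is taken coordinatewise; with the conventions $\log 0=-\infty$ and $e^{-\infty}=0$ this includes points $y=e^v$ with zero coordinates: an option with $v_i=-\infty$ is dropped from the maximum in $W$, so that $H_i(y)=0$ if $y_i=0$, and $H(0)=0$. Let $\Delta$ be the unit simplex in $\mathbb{R}^N$, and let $f^*(y)=\sup_x\{x\cdot y-f(x)\}$ denote the convex conjugate. Then $W$ is differentiable, $H$ is a bijection of $\mathbb{R}_+^N$ onto itself, and with $S=H^{-1}$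 the following hold. (i) For every $v\in\mathbb{R}^N$, $W(v)=\log\Bigl(\sum_{i=1}^N H_i(e^{v})\Bigr)$, where the sum is positive. (ii) The convex conjugate of $W$ is $$W^*(q)=\begin{cases}\sum_{i=1}^N q_i\log S_i(q), & q\in\Delta,\\ +\infty, & \text{otherwise,}\end{cases}$$ with the convention $0\cdot(-\infty)=0$. (iii) $W$ is the convex conjugate of $W^*$, and for every $v\in\mathbb{R}^N$ $$W(v)=\max_{q\in\Delta}\{q\cdot v-W^*(q)\},$$ where the maximum is attained at the choice probabilities $q(v)=\nabla W(v)\in\Delta$. -/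

import Mathlib

open MeasureTheory

noncomputable section

namespace RandomUtility

/-- The random shocks `ε = (ε₁, …, ε_N)`: a random vector with finite means whose joint law is
absolutely continuous with respect to Lebesgue measure and has full (topological) support `ℝᴺ`.
The law does not involve the deterministic utilities `v`, which is the independence of `v`. -/
structure ShockConditions {N : ℕ} {Ω : Type*} [MeasurableSpace Ω] (P : Measure Ω)
    (ε : Ω → Fin N → ℝ) : Prop where
  measurable : Measurable ε
  finite_mean : ∀ i, Integrable (fun ω => ε ω i) P
  abs_cont : P.map ε ≪ (volume : Measure (Fin N → ℝ))
  full_support : (P.map ε).support = Set.univ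

/-- The gradient as the vector of partial derivatives. -/
def grad {N : ℕ} (f : (Fin N → ℝ) → ℝ) (v : Fin N → ℝ) : Fin N → ℝ :=
  fun i => lineDeriv ℝ f v (Pi.single i 1)

/-- The expected maximal utility `𝔼 max_{i ∈ A} (v_i + ε_i)` when the options are those in the
nonempty set `A`. It does not depend on the `v_j` with `j ∉ A`, and it is the surplus at the
vector of utilities in which each `v_j` with `j ∉ A` is replaced by `-∞`. -/
def surplusOn {N : ℕ} {Ω : Type*} [MeasurableSpace Ω] (P : Measure Ω) (ε : Ω → Fin N → ℝ)
    (A : Finset (Fin N)) (hA : A.Nonempty) (v : Fin N → ℝ) : ℝ :=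
  ∫ ω, A.sup' hA (fun i => v i + ε ω i) ∂P

/-- The surplus function `W(v) = 𝔼 max_i (v_i + ε_i)`. -/
def surplus {N : ℕ} [NeZero N] {Ω : Type*} [MeasurableSpace Ω] (P : Measure Ω)
    (ε : Ω → Fin N → ℝ) (v : Fin N → ℝ) : ℝ :=
  surplusOn P ε Finset.univ Finset.univ_nonempty v

/-- The choice probabilities `q_i(v) = ℙ(v_i + ε_i ≥ v_j + ε_j for all j ≠ i)`. -/
def choiceProb {N : ℕ} {Ω : Type*} [MeasurableSpace Ω] (P : Measure Ω) (ε : Ω → Fin N → ℝ)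
    (v : Fin N → ℝ) : Fin N → ℝ :=
  fun i => P.real {ω | ∀ j, j ≠ i → v j + ε ω j ≤ v i + ε ω i}

/-- The nonnegative orthant `ℝ₊ᴺ`. -/
def orthant (N : ℕ) : Set (Fin N → ℝ) := {y | ∀ i, 0 ≤ y i}

/-- The options that are available at `y = e^v`: those with `y_i > 0`, that is `v_i > -∞`. -/
def available {N : ℕ} (y : Fin N → ℝ) : Finset (Fin N) :=
  Finset.univ.filter (fun i => 0 < y i)

/-- The map `H` on `ℝ₊ᴺ` with `H(e^v) = ∇_v e^{W(v)}`. When all `y_i` are positive, every option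
is available and `H(y)` is the gradient of `e^W` at `v = log y`. A zero coordinate `y_i = 0` stands
for `v_i = -∞`, with `log 0 = -∞`: this option drops out of the maximum in `W`, so that `e^W` does
not depend on `v_i` and the `i`-th partial derivative is `0`. At `y = 0`, where `e^W = 0`, the
value is `0`. -/
def H {N : ℕ} {Ω : Type*} [MeasurableSpace Ω] (P : Measure Ω) (ε : Ω → Fin N → ℝ)
    (y : Fin N → ℝ) : Fin N → ℝ :=
  if hA : (available y).Nonempty then
    grad (fun v => Real.exp (surplusOn P ε (available y) hA v)) (fun i => Real.log (y i))
  else 0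

/-- The generator function `S = H⁻¹`, the inverse of `H` as a map of `ℝ₊ᴺ` to itself. -/
def S {N : ℕ} {Ω : Type*} [MeasurableSpace Ω] (P : Measure Ω) (ε : Ω → Fin N → ℝ) :
    (Fin N → ℝ) → (Fin N → ℝ) :=
  Function.invFunOn (H P ε) (orthant N)

/-- The convex conjugate `f*(y) = sup_x (x · y - f(x))`, with values in `[-∞, ∞]`. -/
def conjugate {N : ℕ} (f : (Fin N → ℝ) → EReal) (y : Fin N → ℝ) : EReal :=
  ⨆ x : Fin N → ℝ, ((x ⬝ᵥ y : ℝ) : EReal) - f x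

/-- The convex conjugate `W*` of the surplus function. -/
def surplusConj {N : ℕ} [NeZero N] {Ω : Type*} [MeasurableSpace Ω] (P : Measure Ω)
    (ε : Ω → Fin N → ℝ) : (Fin N → ℝ) → EReal :=
  conjugate (fun v => (surplus P ε v : EReal))

/-- `q · log s = ∑ q_i log s_i` for `s ∈ ℝ₊ᴺ`, in the extended reals, with the conventions
`log 0 = -∞` and `0 · (-∞) = 0`. -/
def dotLog {N : ℕ} (q s : Fin N → ℝ) : EReal :=
  ∑ i, (q i : EReal) * ENNReal.log (ENNReal.ofReal (s i))

end RandomUtility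

end

noncomputable section

namespace RandomUtility

open Filter Topology

/-! Absolute continuity makes ties null, so for almost every shock the maximum of the utilities
agrees near v with a single coordinate plus a constant. It is 1-Lipschitz in v, so differentiation
passes under the integral and ∇W is the vector of choice probabilities (`hasFDerivAt_surplusOn`);
integrating the pointwise tangent inequality gives the convexity of W in gradient form
(`surplusOn_add_le`).

Since W(v + c) = W(v) + c, the choice probabilities sum to one. Hence H(e^v) = e^W q(v) has
coordinate sum e^W, which is (i). H preserves the zero pattern, so bijectivity is checked on each
face A of the orthant separately. There it says that choice probabilities determine utilities up to
a constant (`exists_const_of_chooseOn_eq`, by full support) and exhaust the relative interior of the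
simplex face (`exists_chooseOn_eq`, by maximising q·x - W_A(x)); the total mass then fixes the
constant.

For q in the simplex and y = S(q), the vector x = log y has W_A(x) = 0 and choice probabilities q,
where A is the support of q. The tangent inequality at x bounds q·z - W(z) by q·x, and this bound is
approached by sending the utilities outside A to -∞. Thus W*(q) = q·log S(q). Part (iii) is
Fenchel–Young, with equality at q = ∇W(v). -/

/-- The event that option `i` attains the maximal utility among the options in `A`. -/
def chooseEvent {N : ℕ} {Ω : Type*} (ε : Ω → Fin N → ℝ) (A : Finset (Fin N)) (v : Fin N → ℝ)
    (i : Fin N) : Set Ω :=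
  {ω | ∀ j ∈ A, v j + ε ω j ≤ v i + ε ω i}

/-- The probability that option `i` attains the maximal utility among the options in `A`. -/
def chooseOn {N : ℕ} {Ω : Type*} [MeasurableSpace Ω] (P : Measure Ω) (ε : Ω → Fin N → ℝ)
    (A : Finset (Fin N)) (v : Fin N → ℝ) (i : Fin N) : ℝ :=
  P.real (chooseEvent ε A v i)

theorem mem_chooseEvent {N : ℕ} {Ω : Type*} {ε : Ω → Fin N → ℝ} {A : Finset (Fin N)}
    {v : Fin N → ℝ} {i : Fin N} {ω : Ω} :
    ω ∈ chooseEvent ε A v i ↔ ∀ j ∈ A, v j + ε ω j ≤ v i + ε ω i :=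
  Iff.rfl

variable {N : ℕ} {Ω : Type*} [MeasurableSpace Ω] {P : Measure Ω} [IsProbabilityMeasure P]
  {ε : Ω → Fin N → ℝ}

/-! ### Null ties and integrability of the maximum -/

theorem volume_tie_eq_zero {i j : Fin N} (hij : i ≠ j) (c : ℝ) :
    (volume : Measure (Fin N → ℝ)) {x | x i - x j = c} = 0 := by
  set L : (Fin N → ℝ) →ₗ[ℝ] ℝ := (LinearMap.proj i : (Fin N → ℝ) →ₗ[ℝ] ℝ) -
    (LinearMap.proj j : (Fin N → ℝ) →ₗ[ℝ] ℝ) with hL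
  have key := Measure.addHaar_affineSubspace (volume : Measure (Fin N → ℝ))
    -- The subspace is proper, hence null: it misses the point with i-th coordinate c + 1 and zeros
    -- elsewhere.
    (AffineSubspace.mk' (Pi.single i c) (LinearMap.ker L)) (by
      intro h
      have : (Pi.single i (c + 1) : Fin N → ℝ) ∈
          AffineSubspace.mk' (Pi.single i c : Fin N → ℝ) (LinearMap.ker L) := by
        rw [h]; trivial
      rw [AffineSubspace.mem_mk', LinearMap.mem_ker] at this
      simp [hL, hij.symm] at this)
  refine measure_mono_null (fun x hx => ?_) key
  have hx' : x i - x j = c := hx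
  rw [SetLike.mem_coe, AffineSubspace.mem_mk', LinearMap.mem_ker]
  simp only [hL, vsub_eq_sub, map_sub, LinearMap.sub_apply, LinearMap.proj_apply,
    Pi.single_eq_same, Pi.single_eq_of_ne hij.symm]
  linarith

omit [IsProbabilityMeasure P] in
theorem ShockConditions.ae_no_tie (hε : ShockConditions P ε) (v : Fin N → ℝ) :
    ∀ᵐ ω ∂P, ∀ i j, i ≠ j → v i + ε ω i ≠ v j + ε ω j := by
  rw [ae_all_iff]; intro i
  rw [ae_all_iff]; intro j
  by_cases hij : i = j
  · simp [hij]
  have h0 : P.map ε {x | x i - x j = v j - v i} = 0 := hε.abs_cont (volume_tie_eq_zero hij _)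
  have h1 : ∀ᵐ x ∂(P.map ε), x i - x j ≠ v j - v i := by
    rw [ae_iff]; simpa using h0
  filter_upwards [ae_of_ae_map hε.measurable.aemeasurable h1] with ω hω _ h
  exact hω (by linarith)

omit [IsProbabilityMeasure P] in
theorem ShockConditions.measure_pos_of_isOpen (hε : ShockConditions P ε) {U : Set (Fin N → ℝ)}
    (hU : IsOpen U) (hne : U.Nonempty) : 0 < P (ε ⁻¹' U) := by
  obtain ⟨x, hx⟩ := hne
  have hs : x ∈ (P.map ε).support := by rw [hε.full_support]; trivial
  have := (Measure.mem_support_iff_forall x).1 hs U (hU.mem_nhds hx)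
  rwa [Measure.map_apply hε.measurable hU.measurableSet] at this

omit [IsProbabilityMeasure P] in
theorem ShockConditions.measurable_apply (hε : ShockConditions P ε) (i : Fin N) :
    Measurable fun ω => ε ω i :=
  (measurable_pi_apply i).comp hε.measurable

omit [IsProbabilityMeasure P] in
theorem ShockConditions.measurableSet_chooseEvent (hε : ShockConditions P ε)
    (A : Finset (Fin N)) (v : Fin N → ℝ) (i : Fin N) :
    MeasurableSet (chooseEvent ε A v i) := by
  have : chooseEvent ε A v i = ⋂ j ∈ A, {ω | v j + ε ω j ≤ v i + ε ω i} := by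
    ext ω; simp [chooseEvent]
  rw [this]
  exact A.measurableSet_biInter fun j _ => measurableSet_le
    ((hε.measurable_apply j).const_add _) ((hε.measurable_apply i).const_add _)

theorem abs_sup'_le_sum (A : Finset (Fin N)) (hA : A.Nonempty) (f : Fin N → ℝ) :
    |A.sup' hA f| ≤ ∑ i, |f i| := by
  obtain ⟨i, -, hi⟩ := A.exists_mem_eq_sup' hA f
  rw [hi]
  exact Finset.single_le_sum (f := fun i => |f i|) (fun j _ => abs_nonneg _) (Finset.mem_univ i)

theorem ShockConditions.integrable_utility (hε : ShockConditions P ε) (v : Fin N → ℝ)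
    (i : Fin N) : Integrable (fun ω => v i + ε ω i) P :=
  (integrable_const _).add (hε.finite_mean i)

omit [IsProbabilityMeasure P] in
theorem ShockConditions.measurable_sup' (hε : ShockConditions P ε) (A : Finset (Fin N))
    (hA : A.Nonempty) (v : Fin N → ℝ) :
    Measurable fun ω => A.sup' hA (fun i => v i + ε ω i) := by
  have := Finset.measurable_sup' (s := A) hA (f := fun i ω => v i + ε ω i)
    fun i _ => (hε.measurable_apply i).const_add _
  convert this using 1
  ext ω
  rw [Finset.sup'_apply]

theorem ShockConditions.integrable_sup' (hε : ShockConditions P ε) (A : Finset (Fin N))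
    (hA : A.Nonempty) (v : Fin N → ℝ) :
    Integrable (fun ω => A.sup' hA (fun i => v i + ε ω i)) P := by
  refine Integrable.mono' (integrable_finsetSum Finset.univ
    fun i _ => (hε.integrable_utility v i).abs) (hε.measurable_sup' A hA v).aestronglyMeasurable ?_
  exact Eventually.of_forall fun ω => abs_sup'_le_sum A hA _

/-! ### Differentiation of the surplus -/

/-- The derivative of `x ↦ max_{i ∈ A} (x_i + ε_i(ω))` at `v` when the maximum has no ties: the
projection to the coordinate that attains the maximum. -/
def argmaxProj (ε : Ω → Fin N → ℝ) (A : Finset (Fin N)) (v : Fin N → ℝ) (ω : Ω) :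
    (Fin N → ℝ) →L[ℝ] ℝ :=
  ∑ i ∈ A, (chooseEvent ε A v i).indicator
    (fun _ => (ContinuousLinearMap.proj i : (Fin N → ℝ) →L[ℝ] ℝ)) ω

omit [MeasurableSpace Ω] in
theorem exists_strict_argmax {A : Finset (Fin N)} (hA : A.Nonempty) {v : Fin N → ℝ} {ω : Ω}
    (hω : ∀ i j, i ≠ j → v i + ε ω i ≠ v j + ε ω j) :
    ∃ i ∈ A, (∀ j ∈ A, j ≠ i → v j + ε ω j < v i + ε ω i) ∧
      argmaxProj ε A v ω = ContinuousLinearMap.proj i := by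
  obtain ⟨i, hi, hsup⟩ := A.exists_mem_eq_sup' hA (fun i => v i + ε ω i)
  have hlt : ∀ j ∈ A, j ≠ i → v j + ε ω j < v i + ε ω i := fun j hj hji =>
    lt_of_le_of_ne (hsup ▸ A.le_sup' (fun i => v i + ε ω i) hj) (hω j i hji)
  refine ⟨i, hi, hlt, ?_⟩
  rw [argmaxProj, Finset.sum_eq_single i]
  · refine Set.indicator_of_mem (mem_chooseEvent.2 fun j hj => ?_) _
    rcases eq_or_ne j i with rfl | hji
    exacts [le_rfl, (hlt j hj hji).le]
  · exact fun j hj hji => Set.indicator_of_notMem (fun h => (hlt j hj hji).not_ge (mem_chooseEvent.1 h i hi)) _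
  · exact fun h => absurd hi h

theorem sup'_eq_of_forall_le {A : Finset (Fin N)} (hA : A.Nonempty) {f : Fin N → ℝ} {i : Fin N}
    (hi : i ∈ A) (h : ∀ j ∈ A, f j ≤ f i) : A.sup' hA f = f i :=
  le_antisymm (Finset.sup'_le hA _ h) (A.le_sup' f hi)

-- Without ties the winner beats its finitely many rivals strictly, and these inequalities persist
-- near v; there the maximum is the winner's coordinate plus a constant.
omit [MeasurableSpace Ω] in
theorem hasFDerivAt_sup' {A : Finset (Fin N)} (hA : A.Nonempty) {v : Fin N → ℝ} {ω : Ω}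
    (hω : ∀ i j, i ≠ j → v i + ε ω i ≠ v j + ε ω j) :
    HasFDerivAt (fun x : Fin N → ℝ => A.sup' hA (fun i => x i + ε ω i)) (argmaxProj ε A v ω) v := by
  obtain ⟨i, hi, hlt, hF⟩ := exists_strict_argmax hA hω
  rw [hF]
  have h1 : HasFDerivAt (fun x : Fin N → ℝ => x i + ε ω i)
      (ContinuousLinearMap.proj i : (Fin N → ℝ) →L[ℝ] ℝ) v :=
    (ContinuousLinearMap.proj i : (Fin N → ℝ) →L[ℝ] ℝ).hasFDerivAt.add_const _
  refine h1.congr_of_eventuallyEq ?_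
  have h2 : ∀ j ∈ A, ∀ᶠ x : Fin N → ℝ in 𝓝 v, x j + ε ω j ≤ x i + ε ω i := by
    intro j hj
    rcases eq_or_ne j i with rfl | hji
    · exact Eventually.of_forall fun _ => le_rfl
    · have hc : ∀ k : Fin N, ContinuousAt (fun x : Fin N → ℝ => x k + ε ω k) v :=
        fun k => (continuous_apply k).continuousAt.add continuousAt_const
      exact ((hc j).eventually_lt (hc i) (hlt j hj hji)).mono fun x hx => hx.le
  filter_upwards [(A.eventually_all).2 h2] with x hx
  exact sup'_eq_of_forall_le hA hi hx

/-- The Lipschitz constant 1 does not depend on the shock, so it is an integrable bound for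
differentiating under the integral. -/
theorem abs_sup'_sub_sup'_le (A : Finset (Fin N)) (hA : A.Nonempty) (x y e : Fin N → ℝ) :
    |A.sup' hA (fun i => x i + e i) - A.sup' hA (fun i => y i + e i)| ≤ ‖x - y‖ := by
  have key : ∀ x y : Fin N → ℝ, A.sup' hA (fun i => x i + e i) ≤
      A.sup' hA (fun i => y i + e i) + ‖x - y‖ := by
    intro x y
    refine Finset.sup'_le hA _ fun i hi => ?_
    have h1 := A.le_sup' (fun i => y i + e i) hi
    have h2 : x i - y i ≤ ‖x - y‖ := (le_abs_self _).trans (norm_le_pi_norm (x - y) i)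
    linarith
  rw [abs_le]
  have h1 := key x y
  have h2 := key y x
  rw [norm_sub_rev] at h2
  constructor <;> linarith

theorem ShockConditions.integrable_indicator_proj (hε : ShockConditions P ε)
    (A : Finset (Fin N)) (v : Fin N → ℝ) (i : Fin N) :
    Integrable (fun ω => (chooseEvent ε A v i).indicator
      (fun _ => (ContinuousLinearMap.proj i : (Fin N → ℝ) →L[ℝ] ℝ)) ω) P :=
  (integrable_const (ContinuousLinearMap.proj i : (Fin N → ℝ) →L[ℝ] ℝ)).indicator
    (hε.measurableSet_chooseEvent A v i)

omit [IsProbabilityMeasure P] in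
theorem integrable_sum_of_forall {ι E : Type*} [NormedAddCommGroup E] (A : Finset ι)
    {f : ι → Ω → E} (hf : ∀ i ∈ A, Integrable (f i) P) :
    Integrable (fun ω => ∑ i ∈ A, f i ω) P :=
  integrable_finsetSum A hf

theorem ShockConditions.integrable_argmaxProj (hε : ShockConditions P ε) (A : Finset (Fin N))
    (v : Fin N → ℝ) : Integrable (fun ω => argmaxProj ε A v ω) P := by
  unfold argmaxProj
  exact integrable_sum_of_forall A fun i _ => hε.integrable_indicator_proj A v i

theorem ShockConditions.integral_argmaxProj (hε : ShockConditions P ε) (A : Finset (Fin N))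
    (v : Fin N → ℝ) :
    ∫ ω, argmaxProj ε A v ω ∂P =
      ∑ i ∈ A, chooseOn P ε A v i • (ContinuousLinearMap.proj i : (Fin N → ℝ) →L[ℝ] ℝ) := by
  unfold argmaxProj
  rw [integral_finsetSum A fun i _ => hε.integrable_indicator_proj A v i]
  refine Finset.sum_congr rfl fun i _ => ?_
  rw [integral_indicator_const _ (hε.measurableSet_chooseEvent A v i)]
  rfl

/-- The gradient of the surplus is the vector of choice probabilities
(the Williams–Daly–Zachary theorem). -/
theorem ShockConditions.hasFDerivAt_surplusOn (hε : ShockConditions P ε) (A : Finset (Fin N))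
    (hA : A.Nonempty) (v : Fin N → ℝ) :
    HasFDerivAt (surplusOn P ε A hA)
      (∑ i ∈ A, chooseOn P ε A v i • (ContinuousLinearMap.proj i : (Fin N → ℝ) →L[ℝ] ℝ)) v := by
  rw [← hε.integral_argmaxProj A v]
  refine (hasFDerivAt_integral_of_dominated_loc_of_lip' (bound := fun _ => (1 : ℝ)) univ_mem
    (fun x _ => (hε.measurable_sup' A hA x).aestronglyMeasurable) (hε.integrable_sup' A hA v)
    (hε.integrable_argmaxProj A v).aestronglyMeasurable ?_ (integrable_const _) ?_).2
  · refine Eventually.of_forall fun ω x _ => ?_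
    rw [one_mul]
    exact abs_sup'_sub_sup'_le A hA x v (ε ω)
  · filter_upwards [hε.ae_no_tie v] with ω hω
    exact hasFDerivAt_sup' hA hω

/-- The gradient inequality for the convex function `W`. -/
theorem ShockConditions.surplusOn_add_le (hε : ShockConditions P ε) (A : Finset (Fin N))
    (hA : A.Nonempty) (v w : Fin N → ℝ) :
    surplusOn P ε A hA v + ∑ i ∈ A, chooseOn P ε A v i * (w i - v i) ≤ surplusOn P ε A hA w := by
  have h1 : ∑ i ∈ A, chooseOn P ε A v i * (w i - v i) = ∫ ω, argmaxProj ε A v ω (w - v) ∂P := by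
    rw [← ContinuousLinearMap.integral_apply (hε.integrable_argmaxProj A v) (w - v),
      hε.integral_argmaxProj A v]
    simp
  have hint : Integrable (fun ω => argmaxProj ε A v ω (w - v)) P :=
    (hε.integrable_argmaxProj A v).apply_continuousLinearMap _
  rw [h1, surplusOn, ← integral_add (hε.integrable_sup' A hA v) hint]
  refine integral_mono_ae ((hε.integrable_sup' A hA v).add hint) (hε.integrable_sup' A hA w) ?_
  -- Pointwise tangent inequality: the winner at v is still available at w, so the maximum at w is
  -- at least its utility there.
  filter_upwards [hε.ae_no_tie v] with ω hω
  obtain ⟨i, hi, hlt, hF⟩ := exists_strict_argmax hA hω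
  have hsup : A.sup' hA (fun i => v i + ε ω i) = v i + ε ω i := by
    refine sup'_eq_of_forall_le (f := fun i => v i + ε ω i) hA hi fun j hj => ?_
    rcases eq_or_ne j i with rfl | hji
    exacts [le_rfl, (hlt j hj hji).le]
  have h2 := A.le_sup' (fun i => w i + ε ω i) hi
  simp only [hsup, hF, ContinuousLinearMap.proj_apply, Pi.sub_apply] at h2 ⊢
  linarith

/-! ### Translation and monotonicity of the surplus -/

omit [IsProbabilityMeasure P] in
theorem surplusOn_congr {A B : Finset (Fin N)} (hA : A.Nonempty) (hB : B.Nonempty) (hAB : A = B)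
    {v w : Fin N → ℝ} (h : ∀ i ∈ A, v i = w i) :
    surplusOn P ε A hA v = surplusOn P ε B hB w := by
  subst hAB
  exact integral_congr_ae (Eventually.of_forall fun ω =>
    Finset.sup'_congr hA rfl fun i hi => by rw [h i hi])

omit [IsProbabilityMeasure P] in
theorem chooseOn_congr {A : Finset (Fin N)} {v w : Fin N → ℝ} (h : ∀ i ∈ A, v i = w i)
    {i : Fin N} (hi : i ∈ A) : chooseOn P ε A v i = chooseOn P ε A w i := by
  unfold chooseOn chooseEvent
  congr 1
  ext ω
  refine forall₂_congr fun j hj => ?_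
  rw [h j hj, h i hi]

theorem ShockConditions.surplusOn_add_const (hε : ShockConditions P ε) (A : Finset (Fin N))
    (hA : A.Nonempty) (v : Fin N → ℝ) (c : ℝ) :
    surplusOn P ε A hA (fun i => v i + c) = surplusOn P ε A hA v + c := by
  have h : ∀ ω, A.sup' hA (fun i => v i + c + ε ω i) = A.sup' hA (fun i => v i + ε ω i) + c := by
    intro ω
    obtain ⟨i, hi, hs⟩ := A.exists_mem_eq_sup' hA (fun i => v i + ε ω i)
    rw [hs, sup'_eq_of_forall_le (f := fun i => v i + c + ε ω i) hA hi]
    · ring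
    · intro j hj
      have := hs ▸ A.le_sup' (fun i => v i + ε ω i) hj
      linarith
  simp only [surplusOn, h]
  rw [integral_add (hε.integrable_sup' A hA v) (integrable_const _)]
  simp

/-- Along the diagonal W is affine with slope 1. The gradient inequality in the directions +1 and -1
bounds the sum from above and from below. -/
theorem ShockConditions.sum_chooseOn (hε : ShockConditions P ε) (A : Finset (Fin N))
    (hA : A.Nonempty) (v : Fin N → ℝ) : ∑ i ∈ A, chooseOn P ε A v i = 1 := by
  have h1 := hε.surplusOn_add_le A hA v (fun i => v i + 1)
  have h2 := hε.surplusOn_add_le A hA v (fun i => v i + -1)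
  rw [hε.surplusOn_add_const] at h1 h2
  simp only [add_sub_cancel_left, ← Finset.sum_mul] at h1 h2
  linarith

theorem ShockConditions.surplusOn_mono_set (hε : ShockConditions P ε) {A B : Finset (Fin N)}
    (hA : A.Nonempty) (hB : B.Nonempty) (hAB : A ⊆ B) (v : Fin N → ℝ) :
    surplusOn P ε A hA v ≤ surplusOn P ε B hB v :=
  integral_mono (hε.integrable_sup' A hA v) (hε.integrable_sup' B hB v)
    fun _ => Finset.sup'_mono _ hAB hA

theorem ShockConditions.surplusOn_mono (hε : ShockConditions P ε) (A : Finset (Fin N))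
    (hA : A.Nonempty) {v w : Fin N → ℝ} (h : ∀ i, v i ≤ w i) :
    surplusOn P ε A hA v ≤ surplusOn P ε A hA w :=
  integral_mono (hε.integrable_sup' A hA v) (hε.integrable_sup' A hA w)
    fun ω => Finset.sup'_mono_fun fun i _ => by linarith [h i]

theorem ShockConditions.le_surplusOn (hε : ShockConditions P ε) (A : Finset (Fin N))
    (hA : A.Nonempty) (v : Fin N → ℝ) {i : Fin N} (hi : i ∈ A) :
    v i + ∫ ω, ε ω i ∂P ≤ surplusOn P ε A hA v := by
  have h : ∫ ω, (v i + ε ω i) ∂P = v i + ∫ ω, ε ω i ∂P := by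
    rw [integral_add (integrable_const _) (hε.finite_mean i)]; simp
  rw [← h]
  exact integral_mono (hε.integrable_utility v i) (hε.integrable_sup' A hA v)
    fun ω => A.le_sup' (fun i => v i + ε ω i) hi

/-! ### Positivity, injectivity and range of the choice probabilities -/

theorem isOpen_strict_argmax (A : Finset (Fin N)) (v : Fin N → ℝ) (i : Fin N) :
    IsOpen {x : Fin N → ℝ | ∀ j ∈ A, j ≠ i → v j + x j < v i + x i} := by
  have h : {x : Fin N → ℝ | ∀ j ∈ A, j ≠ i → v j + x j < v i + x i} =
      ⋂ j ∈ A.erase i, {x : Fin N → ℝ | v j + x j < v i + x i} := by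
    ext x
    simp only [Set.mem_iInter, Finset.mem_erase]
    exact ⟨fun h j hj => h j hj.2 hj.1, fun h j hj hji => h j ⟨hji, hj⟩⟩
  rw [h]
  exact isOpen_biInter_finset fun j _ => isOpen_lt
    (continuous_const.add (continuous_apply j)) (continuous_const.add (continuous_apply i))

omit [MeasurableSpace Ω] in
theorem preimage_strict_argmax_subset (A : Finset (Fin N)) (v : Fin N → ℝ) (i : Fin N) :
    ε ⁻¹' {x : Fin N → ℝ | ∀ j ∈ A, j ≠ i → v j + x j < v i + x i} ⊆ chooseEvent ε A v i := by
  refine fun ω hω => mem_chooseEvent.2 fun j hj => ?_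
  rcases eq_or_ne j i with rfl | hji
  exacts [le_rfl, (hω j hj hji).le]

theorem ShockConditions.chooseOn_pos (hε : ShockConditions P ε) (A : Finset (Fin N))
    (v : Fin N → ℝ) (i : Fin N) : 0 < chooseOn P ε A v i := by
  have h := hε.measure_pos_of_isOpen (isOpen_strict_argmax A v i)
    -- These shocks give option i utility 1 and every other option utility 0.
    ⟨fun j => if j = i then 1 - v j else - v j, fun j _ hji => by simp [hji]⟩
  exact ENNReal.toReal_pos
    (h.trans_le (measure_mono (preimage_strict_argmax_subset A v i))).ne' (measure_ne_top _ _)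

/-- The choice probabilities determine the utilities up to an additive constant. -/
theorem ShockConditions.exists_const_of_chooseOn_eq (hε : ShockConditions P ε)
    {A : Finset (Fin N)} (hA : A.Nonempty) {v w : Fin N → ℝ}
    (h : ∀ i ∈ A, chooseOn P ε A v i = chooseOn P ε A w i) :
    ∃ c : ℝ, ∀ i ∈ A, w i = v i + c := by
  -- Option i gains most in passing from v to w, so it wins at w whenever it wins at v. If some j
  -- gains strictly less, i also wins at w on an open set of shocks where it loses to j at v; full
  -- support makes its probability strictly larger.
  obtain ⟨i, hi, hmax⟩ := A.exists_max_image (fun i => w i - v i) hA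
  refine ⟨w i - v i, fun j hj => ?_⟩
  by_contra hne
  have hlt : w j - v j < w i - v i :=
    lt_of_le_of_ne (hmax j hj) fun h' => hne (by linarith)
  have hji : j ≠ i := by rintro rfl; exact lt_irrefl _ hlt
  set U : Set (Fin N → ℝ) := {x | v i + x i < v j + x j} ∩
    {x : Fin N → ℝ | ∀ k ∈ A, k ≠ i → w k + x k < w i + x i} with hU
  have hUo : IsOpen U := (isOpen_lt (continuous_const.add (continuous_apply i))
    (continuous_const.add (continuous_apply j))).inter (isOpen_strict_argmax A w i)
  have hUne : U.Nonempty := by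
    -- At v, option i has utility 0 and j half the difference of the two gains. At w, option i has
    -- utility w i - v i, j falls short of it by the other half, and the rest by 1.
    refine ⟨fun k => if k = i then - v i else if k = j then
      (w i - v i - (w j - v j)) / 2 - v j else - w k + (w i - v i) - 1, ?_, fun k _ hki => ?_⟩
    · change v i + _ < v j + _
      simp only [if_true, if_neg hji]
      linarith
    · simp only [if_true, if_neg hki]
      split_ifs with hkj
      · subst hkj; linarith
      · linarith
  have hpos := hε.measure_pos_of_isOpen hUo hUne
  have hdisj : Disjoint (chooseEvent ε A v i) (ε ⁻¹' U) := by
    rw [Set.disjoint_left]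
    exact fun ω h1 h2 => (mem_chooseEvent.1 h1 j hj).not_gt h2.1
  have hsub : chooseEvent ε A v i ∪ ε ⁻¹' U ⊆ chooseEvent ε A w i := by
    refine Set.union_subset (fun ω hω => mem_chooseEvent.2 fun k hk => ?_)
      fun ω hω => preimage_strict_argmax_subset A w i hω.2
    have h1 := mem_chooseEvent.1 hω k hk
    have h2 := hmax k hk
    linarith
  have hle := measureReal_mono (μ := P) hsub
  rw [measureReal_union hdisj (hε.measurable hUo.measurableSet)] at hle
  have hpos' : 0 < P.real (ε ⁻¹' U) := ENNReal.toReal_pos hpos.ne' (measure_ne_top _ _)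
  have := h i hi
  simp only [chooseOn] at this
  linarith

/-- Every point of the relative interior of a face of the simplex is a vector of choice
probabilities. -/
theorem ShockConditions.exists_chooseOn_eq (hε : ShockConditions P ε)
    {A : Finset (Fin N)} (hA : A.Nonempty) {q : Fin N → ℝ} (hq : ∀ i ∈ A, 0 < q i)
    (hsum : ∑ i ∈ A, q i = 1) : ∃ x : Fin N → ℝ, ∀ i ∈ A, chooseOn P ε A x i = q i := by
  -- The gradient of f on A is q minus the choice probabilities, so a global maximiser is the
  -- required x.
  set f : (Fin N → ℝ) → ℝ := fun x => ∑ i ∈ A, q i * x i - surplusOn P ε A hA x with hf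
  have hderiv : ∀ x, HasFDerivAt f
      (∑ i ∈ A, q i • (ContinuousLinearMap.proj i : (Fin N → ℝ) →L[ℝ] ℝ) -
      ∑ i ∈ A, chooseOn P ε A x i • (ContinuousLinearMap.proj i : (Fin N → ℝ) →L[ℝ] ℝ)) x := by
    intro x
    have h1 := (∑ i ∈ A, q i • (ContinuousLinearMap.proj i : (Fin N → ℝ) →L[ℝ] ℝ)).hasFDerivAt
      (x := x)
    have h2 : (fun x : Fin N → ℝ => ∑ i ∈ A, q i * x i) =
        ⇑(∑ i ∈ A, q i • (ContinuousLinearMap.proj i : (Fin N → ℝ) →L[ℝ] ℝ)) := by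
      ext x; simp
    rw [← h2] at h1
    exact h1.sub (hε.hasFDerivAt_surplusOn A hA x)
  have hcont : Continuous f := continuous_iff_continuousAt.2 fun x => (hderiv x).continuousAt
  set m : ℝ := ∑ i, |∫ ω, ε ω i ∂P| with hm
  -- R is large enough that q i * R ≥ |m - f 0| for each i in A. As the surplus is at least -m when
  -- the largest utility on A is 0, a coordinate below -R then forces f ≤ f 0.
  set R : ℝ := ∑ i ∈ A, |m - f 0| / q i with hR
  have hR0 : 0 ≤ R := Finset.sum_nonneg fun i hi => div_nonneg (abs_nonneg _) (hq i hi).le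
  set K : Set (Fin N → ℝ) := Set.Icc (fun _ => -R) 0 with hK
  obtain ⟨x, -, hx⟩ := (isCompact_Icc : IsCompact K).exists_isMaxOn
    ⟨0, fun _ => by simpa using hR0, le_rfl⟩ hcont.continuousOn
  have h0K : (0 : Fin N → ℝ) ∈ K := ⟨fun _ => by simpa using hR0, le_rfl⟩
  have hglobal : ∀ z, f z ≤ f x := by
    intro z
    obtain ⟨k, hk, hkmax⟩ := A.exists_max_image z hA
    -- As q sums to 1 on A, f is invariant under translation along the diagonal, and it ignores
    -- coordinates outside A. So the largest coordinate on A may be taken to be 0, and those off A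
    -- to be 0.
    set z' : Fin N → ℝ := fun i => if i ∈ A then z i + - z k else 0 with hz'
    have hfz : f z' = f z := by
      have h1 : surplusOn P ε A hA z' = surplusOn P ε A hA z + - z k := by
        rw [← hε.surplusOn_add_const]
        exact surplusOn_congr hA hA rfl fun i hi => by simp [hz', hi]
      have h2 : ∑ i ∈ A, q i * z' i = ∑ i ∈ A, q i * z i + - z k := by
        calc ∑ i ∈ A, q i * z' i = ∑ i ∈ A, (q i * z i + q i * - z k) :=
              Finset.sum_congr rfl fun i hi => by simp only [hz', if_pos hi]; ring
          _ = _ := by rw [Finset.sum_add_distrib, ← Finset.sum_mul, hsum, one_mul]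
      simp only [hf, h1, h2]
      ring
    have hz'0 : ∀ i, z' i ≤ 0 := by
      intro i
      by_cases hi : i ∈ A
      · simp only [hz', if_pos hi]; linarith [hkmax i hi]
      · simp [hz', hi]
    rw [← hfz]
    by_cases hzK : z' ∈ K
    · exact hx hzK
    · have : ∃ i, z' i < -R := by
        by_contra! hcon
        exact hzK ⟨hcon, hz'0⟩
      obtain ⟨i, hiR⟩ := this
      have hi : i ∈ A := by
        by_contra hi
        simp only [hz', if_neg hi] at hiR
        linarith
      refine le_trans ?_ (hx h0K)
      have h1 : ∑ i ∈ A, q i * z' i ≤ q i * z' i := by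
        rw [← Finset.add_sum_erase A _ hi]
        have : ∑ j ∈ A.erase i, q j * z' j ≤ 0 := Finset.sum_nonpos fun j hj =>
          mul_nonpos_of_nonneg_of_nonpos (hq j (Finset.mem_of_mem_erase hj)).le (hz'0 j)
        linarith
      have h2 := hε.le_surplusOn A hA z' hk
      have h3 : z' k = 0 := by simp [hz', hk]
      have h4 : |∫ ω, ε ω k ∂P| ≤ m :=
        Finset.single_le_sum (f := fun i => |∫ ω, ε ω i ∂P|) (fun j _ => abs_nonneg _)
          (Finset.mem_univ k)
      have h5 := neg_abs_le (∫ ω, ε ω k ∂P)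
      have h6 : |m - f 0| / q i ≤ R :=
        Finset.single_le_sum (f := fun i => |m - f 0| / q i)
          (fun j hj => div_nonneg (abs_nonneg _) (hq j hj).le) hi
      rw [div_le_iff₀ (hq i hi)] at h6
      have h7 := le_abs_self (m - f 0)
      have h8 : q i * z' i ≤ q i * -R := mul_le_mul_of_nonneg_left hiR.le (hq i hi).le
      have h9 : f z' = ∑ i ∈ A, q i * z' i - surplusOn P ε A hA z' := rfl
      rw [h9]
      linarith
  have hzero := IsLocalMax.hasFDerivAt_eq_zero (Eventually.of_forall hglobal) (hderiv x)
  refine ⟨x, fun i hi => ?_⟩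
  have := DFunLike.congr_fun hzero (Pi.single i 1)
  simp [Pi.single_apply, hi] at this
  linarith

/-! ### Options with utility tending to -∞ -/

/-- Sending the utilities outside `A` to `-∞` removes these options from the maximum. -/
theorem ShockConditions.tendsto_surplusOn (hε : ShockConditions P ε) {A B : Finset (Fin N)}
    (hA : A.Nonempty) (hB : B.Nonempty) (hAB : A ⊆ B) (x : Fin N → ℝ) :
    Tendsto (fun n : ℕ => surplusOn P ε B hB (fun i => if i ∈ A then x i else x i - n)) atTop
      (𝓝 (surplusOn P ε A hA x)) := by
  refine tendsto_integral_of_dominated_convergence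
    (fun ω => |A.sup' hA (fun i => x i + ε ω i)| + |B.sup' hB (fun i => x i + ε ω i)|)
    (fun n => (hε.measurable_sup' B hB _).aestronglyMeasurable)
    ((hε.integrable_sup' A hA x).abs.add (hε.integrable_sup' B hB x).abs) ?_ ?_
  · intro n
    refine Eventually.of_forall fun ω => ?_
    have h1 : A.sup' hA (fun i => x i + ε ω i) ≤
        B.sup' hB (fun i => (if i ∈ A then x i else x i - n) + ε ω i) := by
      refine Finset.sup'_le hA _ fun i hi => ?_
      have := B.le_sup' (fun i => (if i ∈ A then x i else x i - n) + ε ω i) (hAB hi)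
      simpa only [if_pos hi] using this
    have h2 : B.sup' hB (fun i => (if i ∈ A then x i else x i - n) + ε ω i) ≤
        B.sup' hB (fun i => x i + ε ω i) := by
      refine Finset.sup'_mono_fun fun i _ => ?_
      split_ifs
      · exact le_rfl
      · have : (0 : ℝ) ≤ n := n.cast_nonneg
        linarith
    rw [Real.norm_eq_abs, abs_le]
    have h3 := neg_abs_le (A.sup' hA (fun i => x i + ε ω i))
    have h4 := le_abs_self (B.sup' hB (fun i => x i + ε ω i))
    have h5 := abs_nonneg (A.sup' hA (fun i => x i + ε ω i))
    have h6 := abs_nonneg (B.sup' hB (fun i => x i + ε ω i))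
    constructor <;> linarith
  -- For fixed ω the sequence is eventually constant: each option outside A finally falls below the
  -- best option k of A.
  · refine Eventually.of_forall fun ω => tendsto_const_nhds.congr' ?_
    obtain ⟨k, hk, hs⟩ := A.exists_mem_eq_sup' hA (fun i => x i + ε ω i)
    have hle : ∀ j ∈ B, ∀ᶠ n : ℕ in atTop,
        (if j ∈ A then x j else x j - n) + ε ω j ≤ x k + ε ω k := by
      intro j _
      by_cases hj : j ∈ A
      · have := hs ▸ A.le_sup' (fun i => x i + ε ω i) hj
        exact Eventually.of_forall fun n => by simpa only [if_pos hj] using this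
      · filter_upwards [eventually_ge_atTop ⌈x j + ε ω j - (x k + ε ω k)⌉₊] with n hn
        have := Nat.ceil_le.1 hn
        simp only [if_neg hj]
        linarith
    filter_upwards [(B.eventually_all).2 hle] with n hn
    rw [hs, sup'_eq_of_forall_le
      (f := fun i => (if i ∈ A then x i else x i - n) + ε ω i) hB (hAB hk)]
    · simp [hk]
    · simpa only [if_pos hk] using hn

/-! ### The map `H` on the faces of the orthant -/

theorem grad_apply_of_hasFDerivAt {f : (Fin N → ℝ) → ℝ} {L : (Fin N → ℝ) →L[ℝ] ℝ} {v : Fin N → ℝ}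
    (h : HasFDerivAt f L v) (i : Fin N) : grad f v i = L (Pi.single i 1) :=
  (h.hasLineDerivAt _).lineDeriv

theorem ShockConditions.grad_surplusOn (hε : ShockConditions P ε) (A : Finset (Fin N))
    (hA : A.Nonempty) (v : Fin N → ℝ) (i : Fin N) :
    grad (surplusOn P ε A hA) v i = if i ∈ A then chooseOn P ε A v i else 0 := by
  rw [grad_apply_of_hasFDerivAt (hε.hasFDerivAt_surplusOn A hA v)]
  simp [Pi.single_apply]

theorem mem_available {y : Fin N → ℝ} {i : Fin N} : i ∈ available y ↔ 0 < y i := by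
  simp [available]

theorem eq_zero_of_notMem_available {y : Fin N → ℝ} (hy : y ∈ orthant N) {i : Fin N}
    (hi : i ∉ available y) : y i = 0 :=
  le_antisymm (not_lt.1 fun h => hi (mem_available.2 h)) (hy i)

theorem ShockConditions.H_apply (hε : ShockConditions P ε) {y : Fin N → ℝ}
    (hA : (available y).Nonempty) (i : Fin N) :
    H P ε y i = if i ∈ available y then
      Real.exp (surplusOn P ε (available y) hA fun j => Real.log (y j)) *
        chooseOn P ε (available y) (fun j => Real.log (y j)) i else 0 := by
  rw [H, dif_pos hA,
    grad_apply_of_hasFDerivAt (hε.hasFDerivAt_surplusOn (available y) hA _).exp]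
  simp [Pi.single_apply]

/-- Full support makes every available option's choice probability positive. Hence `H` maps each
open face of the orthant to itself, and bijectivity can be checked face by face. -/
theorem ShockConditions.H_pos_iff (hε : ShockConditions P ε) (y : Fin N → ℝ) (i : Fin N) :
    0 < H P ε y i ↔ 0 < y i := by
  by_cases hA : (available y).Nonempty
  · rw [hε.H_apply hA i, ← mem_available]
    split_ifs with hi
    · exact iff_of_true (mul_pos (Real.exp_pos _) (hε.chooseOn_pos _ _ _)) hi
    · simp [hi]
  · rw [H, dif_neg hA]
    exact iff_of_false (lt_irrefl _) fun h => hA ⟨i, mem_available.2 h⟩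

theorem ShockConditions.available_H (hε : ShockConditions P ε) (y : Fin N → ℝ) :
    available (H P ε y) = available y := by
  ext i
  rw [mem_available, mem_available, hε.H_pos_iff]

theorem ShockConditions.H_mem_orthant (hε : ShockConditions P ε) (y : Fin N → ℝ) :
    H P ε y ∈ orthant N := by
  intro i
  by_cases hA : (available y).Nonempty
  · rw [hε.H_apply hA i]
    split_ifs
    · exact (mul_pos (Real.exp_pos _) (hε.chooseOn_pos _ _ _)).le
    · exact le_rfl
  · rw [H, dif_neg hA]
    exact le_rfl

theorem ShockConditions.sum_H (hε : ShockConditions P ε) {y : Fin N → ℝ}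
    (hA : (available y).Nonempty) :
    ∑ i, H P ε y i = Real.exp (surplusOn P ε (available y) hA fun j => Real.log (y j)) := by
  simp only [hε.H_apply hA]
  rw [Finset.sum_ite_mem, Finset.univ_inter, ← Finset.mul_sum, hε.sum_chooseOn _ hA, mul_one]

/-- The coordinate sum recovers the surplus, and division by it the choice probabilities. These fix
log y up to a constant on the face, and equality of the surpluses makes the constant 0. -/
theorem ShockConditions.injOn_H (hε : ShockConditions P ε) :
    Set.InjOn (H P ε) (orthant N) := by
  intro y hy z hz hyz
  have hav : available y = available z := by
    rw [← hε.available_H y, hyz, hε.available_H z]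
  by_cases hA : (available y).Nonempty
  · have hB : (available z).Nonempty := hav ▸ hA
    have hcongr : ∀ w, surplusOn P ε (available z) hB w = surplusOn P ε (available y) hA w :=
      fun w => surplusOn_congr hB hA hav.symm fun _ _ => rfl
    have hW : surplusOn P ε (available y) hA (fun j => Real.log (y j)) =
        surplusOn P ε (available y) hA (fun j => Real.log (z j)) := by
      rw [← hcongr fun j => Real.log (z j)]
      exact Real.exp_injective (by rw [← hε.sum_H hA, ← hε.sum_H hB, hyz])
    obtain ⟨c, hc⟩ := hε.exists_const_of_chooseOn_eq hA (v := fun j => Real.log (y j))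
      (w := fun j => Real.log (z j)) (by
        intro i hi
        have h := congrFun hyz i
        rw [hε.H_apply hA, hε.H_apply hB, if_pos hi, if_pos (hav ▸ hi), hcongr, ← hW, ← hav] at h
        exact mul_left_cancel₀ (Real.exp_pos _).ne' h)
    have hc0 : c = 0 := by
      have h1 := hε.surplusOn_add_const (available y) hA (fun j => Real.log (y j)) c
      rw [surplusOn_congr hA hA rfl fun i hi => (hc i hi).symm, ← hW] at h1
      linarith
    ext i
    by_cases hi : i ∈ available y
    · have h := hc i hi
      rw [hc0, add_zero] at h
      exact Real.log_injOn_pos (mem_available.1 hi) (mem_available.1 (hav ▸ hi)) h.symm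
    · rw [eq_zero_of_notMem_available hy hi, eq_zero_of_notMem_available hz (hav ▸ hi)]
  · have hB : ¬ (available z).Nonempty := hav ▸ hA
    ext i
    rw [eq_zero_of_notMem_available hy fun hi => hA ⟨i, hi⟩,
      eq_zero_of_notMem_available hz fun hi => hB ⟨i, hi⟩]

theorem ShockConditions.surjOn_H (hε : ShockConditions P ε) :
    Set.SurjOn (H P ε) (orthant N) (orthant N) := by
  intro z hz
  by_cases hA : (available z).Nonempty
  · set s : ℝ := ∑ i ∈ available z, z i with hs
    have hs0 : 0 < s := Finset.sum_pos (fun i hi => mem_available.1 hi) hA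
    obtain ⟨x, hx⟩ := hε.exists_chooseOn_eq hA (q := fun i => z i / s)
      (fun i hi => div_pos (mem_available.1 hi) hs0)
      (by rw [← Finset.sum_div, ← hs, div_self hs0.ne'])
    -- The shift c raises the surplus at x to log s and leaves the choice probabilities z i / s
    -- unchanged.
    set c : ℝ := Real.log s - surplusOn P ε (available z) hA x with hc
    set y : Fin N → ℝ := fun i => if i ∈ available z then Real.exp (x i + c) else 0 with hy
    have hav : available y = available z := by
      ext i
      rw [mem_available]
      by_cases hi : i ∈ available z
      · simp [hy, hi, Real.exp_pos]
      · simp [hy, hi]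
    have hB : (available y).Nonempty := hav ▸ hA
    have hlog : ∀ i ∈ available z, Real.log (y i) = x i + c := by
      intro i hi
      simp [hy, hi]
    refine ⟨y, fun i => ?_, ?_⟩
    · by_cases hi : i ∈ available z
      · simp only [hy, if_pos hi]; exact (Real.exp_pos _).le
      · simp [hy, hi]
    · ext i
      rw [hε.H_apply hB]
      have hW : surplusOn P ε (available y) hB (fun j => Real.log (y j)) = Real.log s := by
        rw [surplusOn_congr hB hA hav fun j hj => hlog j (hav ▸ hj), hε.surplusOn_add_const, hc]
        ring
      rw [hW, Real.exp_log hs0, hav]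
      split_ifs with hi
      · have hq : chooseOn P ε (available z) (fun j => x j + c) i =
            chooseOn P ε (available z) x i := by
          unfold chooseOn chooseEvent
          congr 1
          ext ω
          refine forall₂_congr fun j _ => ?_
          constructor <;> intro h <;> linarith
        rw [chooseOn_congr hlog hi, hq, hx i hi]
        field_simp
      · exact (eq_zero_of_notMem_available hz hi).symm
  · refine ⟨z, hz, ?_⟩
    rw [H, dif_neg hA]
    ext i
    exact (eq_zero_of_notMem_available hz fun hi => hA ⟨i, hi⟩).symm

theorem ShockConditions.bijOn_H (hε : ShockConditions P ε) :
    Set.BijOn (H P ε) (orthant N) (orthant N) :=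
  ⟨fun y _ => hε.H_mem_orthant y, hε.injOn_H, hε.surjOn_H⟩

/-! ### The convex conjugate of the surplus -/

theorem dotLog_eq {q s : Fin N → ℝ} (h : ∀ i, q i ≠ 0 → 0 < s i) :
    dotLog q s = ((∑ i, q i * Real.log (s i) : ℝ) : EReal) := by
  have hcoe : ∀ (A : Finset (Fin N)) (f : Fin N → ℝ),
      ((∑ i ∈ A, f i : ℝ) : EReal) = ∑ i ∈ A, (f i : EReal) := by
    intro A f
    induction A using Finset.induction_on with
    | empty => simp
    | insert i A hi ih => rw [Finset.sum_insert hi, Finset.sum_insert hi, EReal.coe_add, ih]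
  rw [dotLog, hcoe]
  refine Finset.sum_congr rfl fun i _ => ?_
  by_cases hi : q i = 0
  · simp [hi]
  · rw [ENNReal.log_ofReal_of_pos (h i hi), EReal.coe_mul]

variable [NeZero N]

omit [IsProbabilityMeasure P] in
theorem le_surplusConj (P : Measure Ω) (ε : Ω → Fin N → ℝ) (q x : Fin N → ℝ) :
    ((x ⬝ᵥ q - surplus P ε x : ℝ) : EReal) ≤ surplusConj P ε q := by
  rw [EReal.coe_sub]
  exact le_iSup (fun x : Fin N → ℝ => ((x ⬝ᵥ q : ℝ) : EReal) - (surplus P ε x : EReal)) x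

omit [IsProbabilityMeasure P] in
theorem surplusConj_le {q : Fin N → ℝ} {c : ℝ} (h : ∀ x, x ⬝ᵥ q - surplus P ε x ≤ c) :
    surplusConj P ε q ≤ c :=
  iSup_le fun x => by
    rw [← EReal.coe_sub]
    exact EReal.coe_le_coe_iff.2 (h x)

/-- If q does not sum to 1, then x·q - W(x) is affine with nonzero slope along the diagonal. If some
q i is negative, lowering x i alone raises x·q without bound and does not raise W. Both witnesses
are scaled to reach M + 1. -/
theorem ShockConditions.surplusConj_of_notMem (hε : ShockConditions P ε) {q : Fin N → ℝ}
    (hq : q ∉ stdSimplex ℝ (Fin N)) : surplusConj P ε q = ⊤ := by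
  rw [EReal.eq_top_iff_forall_lt]
  intro M
  suffices h : ∃ x : Fin N → ℝ, M + 1 ≤ x ⬝ᵥ q - surplus P ε x by
    obtain ⟨x, hx⟩ := h
    exact (EReal.coe_lt_coe_iff.2 (by linarith)).trans_le (le_surplusConj P ε q x)
  by_cases hsum : ∑ i, q i = 1
  · have : ∃ i, q i < 0 := by
      by_contra! h
      exact hq ⟨h, hsum⟩
    obtain ⟨i, hi⟩ := this
    set t : ℝ := |M + 1 + surplus P ε 0| / -q i with ht
    have ht0 : 0 ≤ t := div_nonneg (abs_nonneg _) (by linarith)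
    refine ⟨Pi.single i (-t), ?_⟩
    have h1 : surplus P ε (Pi.single i (-t)) ≤ surplus P ε 0 := by
      refine hε.surplusOn_mono _ _ fun j => ?_
      rcases eq_or_ne j i with rfl | hji
      · simpa using ht0
      · simp [hji]
    have h2 : t * -q i = |M + 1 + surplus P ε 0| := div_mul_cancel₀ _ (by linarith)
    have h3 := le_abs_self (M + 1 + surplus P ε 0)
    rw [single_dotProduct]
    linarith
  · have hne : ∑ i, q i - 1 ≠ 0 := sub_ne_zero.2 hsum
    set c : ℝ := (M + 1 + surplus P ε 0) / (∑ i, q i - 1) with hc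
    refine ⟨fun _ => c, ?_⟩
    have h1 : surplus P ε (fun _ => c) = surplus P ε 0 + c := by
      have := hε.surplusOn_add_const Finset.univ Finset.univ_nonempty 0 c
      simp only [Pi.zero_apply, zero_add] at this
      exact this
    have h2 : c * (∑ i, q i - 1) = M + 1 + surplus P ε 0 := div_mul_cancel₀ _ hne
    have h3 : (fun _ => c) ⬝ᵥ q = c * ∑ i, q i := by
      simp only [dotProduct, Finset.mul_sum]
    rw [h1, h3]
    linarith

theorem ShockConditions.surplusConj_of_mem (hε : ShockConditions P ε) {q : Fin N → ℝ}
    (hq : q ∈ stdSimplex ℝ (Fin N)) : surplusConj P ε q = dotLog q (S P ε q) := by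
  have hex : ∃ y ∈ orthant N, H P ε y = q := hε.surjOn_H hq.1
  have hyH : H P ε (S P ε q) = q := Function.invFunOn_eq hex
  generalize S P ε q = y at hyH
  -- Off `available y` the value of `Real.log` has no meaning; it is harmless because q vanishes
  -- there.
  set x : Fin N → ℝ := fun i => Real.log (y i) with hx
  have hav : available q = available y := by rw [← hyH, hε.available_H]
  have hA : (available y).Nonempty := by
    rw [← hav]
    by_contra hne
    have h := hq.2
    rw [Finset.sum_eq_zero fun i _ =>
      eq_zero_of_notMem_available (y := q) hq.1 fun hi => hne ⟨i, hi⟩] at h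
    exact zero_ne_one h
  have hW : surplusOn P ε (available y) hA x = 0 := by
    have h := hε.sum_H hA
    rw [hyH, hq.2] at h
    exact Real.exp_eq_one_iff _ |>.1 h.symm
  have hqA : ∀ i ∈ available y, chooseOn P ε (available y) x i = q i := by
    intro i hi
    have h := congrFun hyH i
    rw [hε.H_apply hA, if_pos hi] at h
    rw [← h, hW, Real.exp_zero, one_mul]
  have hq0 : ∀ i ∉ available y, q i = 0 := fun i hi =>
    eq_zero_of_notMem_available (y := q) hq.1 (hav ▸ hi)
  have hdot : ∀ z : Fin N → ℝ, z ⬝ᵥ q = ∑ i ∈ available y, q i * z i := by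
    intro z
    rw [dotProduct, ← Finset.sum_subset (Finset.subset_univ (available y)) fun i _ hi => by
      rw [hq0 i hi, mul_zero]]
    exact Finset.sum_congr rfl fun i _ => mul_comm _ _
  rw [dotLog_eq fun i hi => mem_available.1 (by_contra fun h => hi (hq0 i h))]
  have hval : ∑ i, q i * Real.log (y i) = x ⬝ᵥ q :=
    Finset.sum_congr rfl fun i _ => mul_comm _ _
  rw [hval]
  refine le_antisymm (surplusConj_le fun z => ?_) ?_
  -- Upper bound: the tangent inequality at x for the surplus on the face, which is at most the full
  -- surplus.
  · have h1 := hε.surplusOn_add_le (available y) hA x z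
    have h2 : surplusOn P ε (available y) hA z ≤ surplus P ε z :=
      hε.surplusOn_mono_set hA Finset.univ_nonempty (Finset.subset_univ _) z
    have h3 : ∑ i ∈ available y, chooseOn P ε (available y) x i * (z i - x i) =
        z ⬝ᵥ q - x ⬝ᵥ q := by
      rw [hdot, hdot, ← Finset.sum_sub_distrib]
      exact Finset.sum_congr rfl fun i hi => by rw [hqA i hi]; ring
    rw [hW, h3] at h1
    linarith
  -- Lower bound: for q on the boundary, x lives on a face only, so the value x·q is reached as a
  -- limit along utilities tending to -∞ off the face. The pairing with q is unaffected.
  · have hlim := (hε.tendsto_surplusOn hA Finset.univ_nonempty (Finset.subset_univ _) x).const_sub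
      (x ⬝ᵥ q)
    rw [hW, sub_zero] at hlim
    refine le_of_tendsto ((continuous_coe_real_ereal.tendsto _).comp hlim)
      (Eventually.of_forall fun n => ?_)
    have h1 : x ⬝ᵥ q = (fun i => if i ∈ available y then x i else x i - n) ⬝ᵥ q := by
      rw [hdot, hdot]
      exact Finset.sum_congr rfl fun i hi => by rw [if_pos hi]
    simp only [Function.comp_apply]
    rw [h1]
    exact le_surplusConj P ε q _

/-! ### Choice probabilities and Fenchel–Young duality -/

omit [IsProbabilityMeasure P] [NeZero N] in
theorem choiceProb_eq_chooseOn (v : Fin N → ℝ) :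
    choiceProb P ε v = chooseOn P ε Finset.univ v := by
  ext i
  unfold choiceProb chooseOn chooseEvent
  congr 1
  ext ω
  refine ⟨fun h j _ => ?_, fun h j _ => h j (Finset.mem_univ j)⟩
  rcases eq_or_ne j i with rfl | hji
  exacts [le_rfl, h j hji]

theorem ShockConditions.choiceProb_eq_grad (hε : ShockConditions P ε) (v : Fin N → ℝ) :
    choiceProb P ε v = grad (surplus P ε) v := by
  ext i
  have h := hε.grad_surplusOn Finset.univ Finset.univ_nonempty v i
  rw [if_pos (Finset.mem_univ i)] at h
  rw [choiceProb_eq_chooseOn, ← h]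
  rfl

theorem ShockConditions.choiceProb_mem_stdSimplex (hε : ShockConditions P ε) (v : Fin N → ℝ) :
    choiceProb P ε v ∈ stdSimplex ℝ (Fin N) := by
  rw [choiceProb_eq_chooseOn]
  exact ⟨fun i => (hε.chooseOn_pos _ v i).le, hε.sum_chooseOn _ Finset.univ_nonempty v⟩

/-- The equality case of the Fenchel–Young inequality. -/
theorem ShockConditions.surplusConj_choiceProb (hε : ShockConditions P ε) (v : Fin N → ℝ) :
    surplusConj P ε (choiceProb P ε v) =
      ((choiceProb P ε v ⬝ᵥ v - surplus P ε v : ℝ) : EReal) := by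
  rw [dotProduct_comm]
  refine le_antisymm (surplusConj_le fun x => ?_) (le_surplusConj P ε _ v)
  have h : surplus P ε v + ∑ i, chooseOn P ε Finset.univ v i * (x i - v i) ≤ surplus P ε x :=
    hε.surplusOn_add_le Finset.univ Finset.univ_nonempty v x
  have h2 : ∑ i, chooseOn P ε Finset.univ v i * (x i - v i) =
      x ⬝ᵥ choiceProb P ε v - v ⬝ᵥ choiceProb P ε v := by
    rw [choiceProb_eq_chooseOn, dotProduct, dotProduct, ← Finset.sum_sub_distrib]
    exact Finset.sum_congr rfl fun i _ => by ring
  rw [h2] at h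
  linarith

omit [IsProbabilityMeasure P] in
/-- The Fenchel–Young inequality. -/
theorem dotProduct_sub_surplusConj_le (P : Measure Ω) (ε : Ω → Fin N → ℝ) (q v : Fin N → ℝ) :
    ((q ⬝ᵥ v : ℝ) : EReal) - surplusConj P ε q ≤ surplus P ε v := by
  refine EReal.sub_le_of_le_add ?_
  calc ((q ⬝ᵥ v : ℝ) : EReal)
      = (surplus P ε v : EReal) + ((v ⬝ᵥ q - surplus P ε v : ℝ) : EReal) := by
        rw [← EReal.coe_add, dotProduct_comm]
        congr 1
        ring
    _ ≤ _ := add_le_add_right (le_surplusConj P ε q v) _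

theorem ShockConditions.dotProduct_choiceProb_sub (hε : ShockConditions P ε) (v : Fin N → ℝ) :
    ((choiceProb P ε v ⬝ᵥ v : ℝ) : EReal) - surplusConj P ε (choiceProb P ε v) =
      (surplus P ε v : EReal) := by
  rw [hε.surplusConj_choiceProb v, ← EReal.coe_sub]
  congr 1
  ring

end RandomUtility

end

open RandomUtility in
open Classical in
theorem proposition1 {N : ℕ} [NeZero N] {Ω : Type*} [MeasurableSpace Ω]
    (P : MeasureTheory.Measure Ω) [MeasureTheory.IsProbabilityMeasure P]
    (ε : Ω → Fin N → ℝ) (hε : ShockConditions P ε) :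
    -- the objects are well defined: `W` is differentiable, and `H` is a bijection of `ℝ₊ᴺ`
    (Differentiable ℝ (surplus P ε) ∧ Set.BijOn (H P ε) (orthant N) (orthant N)) ∧
    -- (i)
    (∀ v : Fin N → ℝ,
      0 < ∑ i, H P ε (fun j => Real.exp (v j)) i ∧
      surplus P ε v = Real.log (∑ i, H P ε (fun j => Real.exp (v j)) i)) ∧
    -- (ii)
    (∀ q : Fin N → ℝ,
      surplusConj P ε q = if q ∈ stdSimplex ℝ (Fin N) then dotLog q (S P ε q) else ⊤) ∧
    -- (iii)
    (∀ v : Fin N → ℝ,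
      (surplus P ε v : EReal) = conjugate (surplusConj P ε) v ∧
      IsGreatest ((fun q : Fin N → ℝ => ((q ⬝ᵥ v : ℝ) : EReal) - surplusConj P ε q) ''
        stdSimplex ℝ (Fin N)) (surplus P ε v : EReal) ∧
      choiceProb P ε v = grad (surplus P ε) v ∧
      choiceProb P ε v ∈ stdSimplex ℝ (Fin N) ∧
      ((choiceProb P ε v ⬝ᵥ v : ℝ) : EReal) - surplusConj P ε (choiceProb P ε v)
        = (surplus P ε v : EReal)) := by
  refine ⟨⟨fun v => (hε.hasFDerivAt_surplusOn Finset.univ Finset.univ_nonempty v).differentiableAt,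
    hε.bijOn_H⟩, fun v => ?_, fun q => ?_, fun v => ⟨?_, ⟨?_, ?_⟩, hε.choiceProb_eq_grad v,
    hε.choiceProb_mem_stdSimplex v, hε.dotProduct_choiceProb_sub v⟩⟩
  · have hav : available (fun j => Real.exp (v j)) = Finset.univ :=
      Finset.eq_univ_of_forall fun i => mem_available.2 (Real.exp_pos _)
    have hA : (available fun j => Real.exp (v j)).Nonempty := hav ▸ Finset.univ_nonempty
    have hW : surplusOn P ε (available fun j => Real.exp (v j)) hA
        (fun j => Real.log (Real.exp (v j))) = surplus P ε v :=
      surplusOn_congr hA Finset.univ_nonempty hav fun i _ => Real.log_exp _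
    rw [hε.sum_H hA, hW, Real.log_exp]
    exact ⟨Real.exp_pos _, rfl⟩
  · split_ifs with hq
    exacts [hε.surplusConj_of_mem hq, hε.surplusConj_of_notMem hq]
  -- Biconjugation needs no separation argument: Fenchel–Young gives one inequality, and its
  -- equality case at the choice probabilities the other.
  · refine le_antisymm ?_ (iSup_le fun q => dotProduct_sub_surplusConj_le P ε q v)
    rw [← hε.dotProduct_choiceProb_sub v]
    exact le_iSup (fun q : Fin N → ℝ => ((q ⬝ᵥ v : ℝ) : EReal) - surplusConj P ε q) _
  · exact ⟨_, hε.choiceProb_mem_stdSimplex v, hε.dotProduct_choiceProb_sub v⟩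
  · rintro _ ⟨q, -, rfl⟩
    exact dotProduct_sub_surplusConj_le P ε q v
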